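/- Let $k$ be a field, $C$ a $k$-coalgebra with comultiplication $\Delta$, and $C^*$ its dual algebra under convolution. All comodules are right $C$-comodules $(M,\rho)$, $\rho: M\to M\otimes C$; $C^*$ acts on $M$ by $f\cdot m=\sum m_{(0)}f(m_{(1)})$. **Notions for $C$.** A subcoalgebra $D$ is *simple* if it has no subcoalgebras other than $0$ and $D$ (so $D=0$ is allowed). For subspaces $X,Y\subseteq C$, $X\wedge Y$ is the kernel of $C\xrightarrow{\Delta}C\otimes C\to C/X\otimes C/Y$. $C$ is *$\pi$-commutative* if $D\wedge E=E\wedge D$ for all simple subcoalgebras $D,E$ of $C$. A coalgebra is *irreducible* if it is nonzero and any two of its nonzero subcoalgebras have nonzero intersection (equivalently, it has exactly one nonzero simple subcoalgebra). $C$ is *decomposable* if it is the direct sum of two nonzero subcoalgebras. **Notions for $M$.** For a subspace $N\subseteq M$ and a subset $P\subseteq C^*$ put $N^{\perp C^*}=\{f\in C^*: f\cdot N=0\}$ and $P^{\perp M}=\{x\in M: P\cdot x=0\}$, and let $\langle N\rangle=N^{\perp C^*\perp M}$. A subcomodule $N$ is *closed* if $\langle N\rangle=N$, and *weak-closed* if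 $\langle C^*x\rangle\subseteq N$ for every $x\in N$. A *minimal closed* subcomodule is a closed subcomodule $N$ such that every nonzero closed subcomodule of $M$ contained in $N$ equals $N$ (so $N=0$ is allowed). For subcomodules $N,L$ put $N\wedge L=(N^{\perp C^*}L^{\perp C^*})^{\perp M}$. $M$ is *$\pi$-commutative* if $N\wedge L=L\wedge N$ for all minimal closed subcomodules $N,L$ of $M$. A subcomodule $N$ of $M$ is *relative-irreducible* if it contains exactly one nonzero minimal closed subcomodule of $M$; $M$ is relative-irreducible if this holds for $N=M$. $M$ is *decomposable* if it is the direct sum of two nonzero weak-closed subcomodules. For a subcoalgebra $E$, $M_E$ is the sum of all subcomodules $N$ of $M$ with $\rho(N)\subseteq N\otimes E$; $M$ is *component-faithful* if $M_D\neq 0$ for every nonzero simple subcoalgebra $D$ of $C$. **Corollary.** 1. If $C$ is $\pi$-commutative, then every $C$-comodule is $\pi$-commutative. 2. If $C$ is a direct sum of irreducible subcoalgebras, then every $C$-comodule is a direct sum of relative-irreducible subcomodules. 3. If $C$ is decomposable, then every component-faithful $C$-comodule is decomposable. 4. If $C$ is irreducible, then every nonzero $C$-comodule is relative-irreducible. 5.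 $C$ is irreducible if and only if every component-faithful $C$-comodule is relative-irreducible. -/

import Mathlib

open TensorProduct Coalgebra

universe u v w

/-- A right comodule over the `k`-coalgebra `C`: a coassociative and counital coaction
`ρ : M → M ⊗ C`. -/
class RightComodule (k : Type u) (C : Type v) (M : Type w) [Field k] [AddCommGroup C] [Module k C]
    [Coalgebra k C] [AddCommGroup M] [Module k M] where
  coact : M →ₗ[k] M ⊗[k] C
  coact_coassoc : (TensorProduct.assoc k M C C).toLinearMap ∘ₗ coact.rTensor C ∘ₗ coact =
    (comul (R := k) (A := C)).lTensor M ∘ₗ coact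
  coact_counit : (counit (R := k) (A := C)).lTensor M ∘ₗ coact = (TensorProduct.mk k M k).flip 1

namespace ComoduleDecomposition

/-- The subspaces in `S` are the summands of an internal direct sum decomposition of `V`. -/
def IsDirectSumOf {k : Type u} {V : Type v} [Field k] [AddCommGroup V] [Module k V]
    (S : Set (Submodule k V)) : Prop :=
  open scoped Classical in DirectSum.IsInternal (fun N : S => (N : Submodule k V))

section Coalgebras

variable {k : Type u} {C : Type v} [Field k] [AddCommGroup C] [Module k C] [Coalgebra k C]

/-- `Δ(D) ⊆ D ⊗ D`. -/
def IsSubcoalgebra (D : Submodule k C) : Prop :=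
  ∀ c ∈ D, comul (R := k) c ∈ LinearMap.range (TensorProduct.mapIncl D D)

/-- `D` is a subcoalgebra without nonzero proper subcoalgebras. The zero subcoalgebra is allowed;
`D ≠ ⊥` is said separately where it is meant. -/
def IsSimpleSubcoalgebra (D : Submodule k C) : Prop :=
  IsSubcoalgebra D ∧ ∀ E : Submodule k C, IsSubcoalgebra E → E ≠ ⊥ → E ≤ D → E = D

/-- `X ∧ Y`, the kernel of `C → C ⊗ C → C/X ⊗ C/Y`. -/
def coalgebraWedge (X Y : Submodule k C) : Submodule k C :=
  LinearMap.ker (TensorProduct.map X.mkQ Y.mkQ ∘ₗ comul (R := k) (A := C))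

/-- `D` is an irreducible subcoalgebra: it is nonzero, and any two nonzero subcoalgebras of `D`
have nonzero intersection. -/
def IsIrreducibleSubcoalgebra (D : Submodule k C) : Prop :=
  IsSubcoalgebra D ∧ D ≠ ⊥ ∧
    ∀ E F : Submodule k C, IsSubcoalgebra E → IsSubcoalgebra F → E ≤ D → F ≤ D →
      E ≠ ⊥ → F ≠ ⊥ → E ⊓ F ≠ ⊥

variable (k C)

def IsPiCommutativeCoalgebra : Prop :=
  ∀ D E : Submodule k C, IsSimpleSubcoalgebra D → IsSimpleSubcoalgebra E →
    coalgebraWedge D E = coalgebraWedge E D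

def IsIrreducibleCoalgebra : Prop :=
  IsIrreducibleSubcoalgebra (⊤ : Submodule k C)

/-- `C` is the direct sum of two nonzero subcoalgebras. -/
def IsDecomposableCoalgebra : Prop :=
  ∃ D E : Submodule k C, IsSubcoalgebra D ∧ IsSubcoalgebra E ∧ D ≠ ⊥ ∧ E ≠ ⊥ ∧ IsCompl D E

end Coalgebras

section Comodules

variable {k : Type u} {C : Type v} {M : Type w} [Field k] [AddCommGroup C] [Module k C]
  [Coalgebra k C] [AddCommGroup M] [Module k M] [RightComodule k C M]

variable (M) in
/-- The left action of `C^*` on `M`: `f · m = ∑ m₍₀₎ f(m₍₁₎)`. -/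
noncomputable def act (f : Module.Dual k C) : M →ₗ[k] M :=
  (TensorProduct.rid k M).toLinearMap ∘ₗ f.lTensor M ∘ₗ RightComodule.coact

/-- `P^{⊥M} = {x ∈ M | P · x = 0}` for `P ⊆ C^*`. -/
def annComodule (M : Type w) [AddCommGroup M] [Module k M] [RightComodule k C M]
    (P : Set (Module.Dual k C)) : Submodule k M where
  carrier := {x | ∀ f ∈ P, act M f x = 0}
  add_mem' hx hy f hf := by rw [map_add, hx f hf, hy f hf, add_zero]
  zero_mem' f _ := map_zero _
  smul_mem' c x hx f hf := by rw [map_smul, hx f hf, smul_zero]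

variable (C)

/-- `ρ(N) ⊆ N ⊗ C`. -/
def IsSubcomodule (N : Submodule k M) : Prop :=
  ∀ x ∈ N, RightComodule.coact (k := k) (C := C) x ∈ LinearMap.range (N.subtype.rTensor C)

/-- `N^{⊥C^*} = {f ∈ C^* | f · N = 0}`. -/
def annDual (N : Submodule k M) : Set (Module.Dual k C) :=
  {f | ∀ x ∈ N, act M f x = 0}

/-- The closure `⟨N⟩ = N^{⊥C^*⊥M}`. -/
def comoduleClosure (N : Submodule k M) : Submodule k M :=
  annComodule M (annDual C N)

/-- The cyclic `C^*`-submodule `C^* · x`. -/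
def cyclic (x : M) : Submodule k M :=
  Submodule.span k (Set.range fun f : Module.Dual k C => act M f x)

def IsClosedSubcomodule (N : Submodule k M) : Prop :=
  IsSubcomodule C N ∧ comoduleClosure C N = N

/-- `⟨x⟩ ⊆ N` for every `x ∈ N`, where `⟨x⟩` is the closure of `C^* · x`. -/
def IsWeakClosedSubcomodule (N : Submodule k M) : Prop :=
  IsSubcomodule C N ∧ ∀ x ∈ N, comoduleClosure C (cyclic (k := k) C x) ≤ N

/-- `N` is a closed subcomodule without nonzero proper closed subcomodules of `M` inside it.
The zero subcomodule is allowed; `N ≠ ⊥` is said separately where it is meant. -/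
def IsMinimalClosedSubcomodule (N : Submodule k M) : Prop :=
  IsClosedSubcomodule C N ∧
    ∀ L : Submodule k M, IsClosedSubcomodule C L → L ≠ ⊥ → L ≤ N → L = N

/-- `N` contains exactly one nonzero minimal closed subcomodule of `M`. -/
def IsRelativeIrreducibleSubcomodule (N : Submodule k M) : Prop :=
  IsSubcomodule C N ∧
    ∃! P : Submodule k M, IsMinimalClosedSubcomodule C P ∧ P ≠ ⊥ ∧ P ≤ N

/-- `N ∧ L = (N^{⊥C^*} L^{⊥C^*})^{⊥M}`, with the convolution product of `C^*`. -/
def comoduleWedge (N L : Submodule k M) : Submodule k M :=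
  annComodule M {h : Module.Dual k C | ∃ f ∈ annDual C N, ∃ g ∈ annDual C L,
    h = (WithConv.toConv f * WithConv.toConv g).ofConv}

variable {C}

/-- `M_E`, the sum of all subcomodules `N` of `M` with `ρ(N) ⊆ N ⊗ E`. -/
def component (M : Type w) [AddCommGroup M] [Module k M] [RightComodule k C M]
    (E : Submodule k C) : Submodule k M :=
  sSup {N : Submodule k M | IsSubcomodule C N ∧
    ∀ x ∈ N, RightComodule.coact x ∈ LinearMap.range (TensorProduct.mapIncl N E)}

variable (k C) (M : Type w) [AddCommGroup M] [Module k M] [RightComodule k C M]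

def IsPiCommutativeComodule : Prop :=
  ∀ N L : Submodule k M, IsMinimalClosedSubcomodule C N → IsMinimalClosedSubcomodule C L →
    comoduleWedge C N L = comoduleWedge C L N

/-- `M` is the direct sum of two nonzero weak-closed subcomodules. -/
def IsDecomposableComodule : Prop :=
  ∃ N L : Submodule k M, IsWeakClosedSubcomodule C N ∧ IsWeakClosedSubcomodule C L ∧
    N ≠ ⊥ ∧ L ≠ ⊥ ∧ IsCompl N L

def IsRelativeIrreducibleComodule : Prop :=
  IsRelativeIrreducibleSubcomodule C (⊤ : Submodule k M)

/-- Every simple subcoalgebra `D` is faithful to `M`, that is, `M_D ≠ 0` or `D = 0`. -/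
def IsComponentFaithful : Prop :=
  ∀ D : Submodule k C, IsSimpleSubcoalgebra D → component M D ≠ ⊥ ∨ D = ⊥

end Comodules

end ComoduleDecomposition

open ComoduleDecomposition

/-! Everything on `M` is pulled back from `C` along a Galois connection. For `N ⊆ M` let `coeffSpace
C N` be spanned by the coefficients `∑ φ(x₍₀₎) x₍₁₎` with `x ∈ N`; for `D ⊆ C` let `coeffIn M D`
consist of the elements with all coefficients in `D`. Then `N^{⊥C^*}` is the annihilator of
`coeffSpace C N`, so the closure is `coeffIn ∘ coeffSpace`, the wedge on `M` is `coeffIn` of the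
wedge on `C`, and `coeffIn` preserves intersections and, for subcoalgebras, direct sums
(`isDirectSumOf_coeffIn`).

The substantial point is that a simple comodule has a simple coefficient coalgebra
(`coeffSpace_le_of_ne_zero`). As every nonzero comodule contains a simple one, nonzero minimal
closed subcomodules are exactly the nonzero `coeffIn M D` with `D` simple. All five claims then
transfer from `C` to `M`; the converse in the last one uses `C` as a comodule over itself. -/

namespace ComoduleDecomposition

/-! ### Tensors tested by pairs of functionals. -/

section Pairing

variable {k : Type u} {C : Type v} {M : Type w} [Field k] [AddCommGroup C] [Module k C]
  [AddCommGroup M] [Module k M]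

/-- The scalar `(φ ⊗ f)(t)`. -/
def pairing (φ : Module.Dual k M) (f : Module.Dual k C) : M ⊗[k] C →ₗ[k] k :=
  LinearMap.mul' k k ∘ₗ TensorProduct.map φ f

theorem pairing_tmul (φ : Module.Dual k M) (f : Module.Dual k C) (m : M) (c : C) :
    pairing φ f (m ⊗ₜ c) = φ m * f c := by
  simp [pairing]

theorem eq_zero_of_forall_pairing {t : M ⊗[k] C}
    (h : ∀ (φ : Module.Dual k M) (f : Module.Dual k C), pairing φ f t = 0) : t = 0 := by
  classical
  let b := Module.Basis.ofVectorSpace k C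
  apply (TensorProduct.equivFinsuppOfBasisRight (M := M) b).injective
  rw [map_zero]
  ext i
  rw [TensorProduct.equivFinsuppOfBasisRight_apply, Finsupp.zero_apply,
    ← Module.forall_dual_apply_eq_zero_iff k]
  intro φ
  rw [← h φ (b.coord i)]
  generalize t = t
  induction t with
  | zero => simp
  | add x y hx hy => simp only [map_add, hx, hy]
  | tmul m c => simp [pairing_tmul, mul_comm]

theorem pairing_map {M' : Type*} {C' : Type*} [AddCommGroup M'] [Module k M'] [AddCommGroup C']
    [Module k C'] (p : M →ₗ[k] M') (q : C →ₗ[k] C') (φ : Module.Dual k M') (f : Module.Dual k C')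
    (t : M ⊗[k] C) : pairing φ f (TensorProduct.map p q t) = pairing (φ ∘ₗ p) (f ∘ₗ q) t := by
  rw [pairing, pairing, TensorProduct.map_comp]
  rfl

/-- For retractions `p`, `q` onto `N`, `D`, the difference of `φp ⊗ fq` and `φ ⊗ f` is a sum of two
pairings, one with first factor killing `N`, one with second factor killing `D`. Hence `p ⊗ q` fixes
`t`. -/
theorem mem_range_mapIncl_iff {N : Submodule k M} {D : Submodule k C} {t : M ⊗[k] C} :
    t ∈ LinearMap.range (TensorProduct.mapIncl N D) ↔
      ∀ (φ : Module.Dual k M) (f : Module.Dual k C),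
        φ ∈ N.dualAnnihilator ∨ f ∈ D.dualAnnihilator → pairing φ f t = 0 := by
  constructor
  · rintro ⟨s, rfl⟩ φ f h
    rw [TensorProduct.mapIncl, pairing_map]
    suffices pairing (φ ∘ₗ N.subtype) (f ∘ₗ D.subtype) = 0 by rw [this, LinearMap.zero_apply]
    ext m c
    simp only [Submodule.mem_dualAnnihilator] at h
    rcases h with h | h <;> simp [pairing_tmul, h]
  · intro h
    obtain ⟨p, hp⟩ := N.subtype.exists_leftInverse_of_injective N.ker_subtype
    obtain ⟨q, hq⟩ := D.subtype.exists_leftInverse_of_injective D.ker_subtype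
    refine ⟨TensorProduct.map p q t, ?_⟩
    rw [TensorProduct.mapIncl, ← LinearMap.comp_apply, ← TensorProduct.map_comp, ← sub_eq_zero]
    apply eq_zero_of_forall_pairing
    intro φ f
    rw [map_sub, pairing_map]
    have h1 := h (φ ∘ₗ N.subtype ∘ₗ p - φ) (f ∘ₗ D.subtype ∘ₗ q) (.inl ?_)
    · have h2 := h φ (f ∘ₗ D.subtype ∘ₗ q - f) (.inr ?_)
      · have key : pairing (φ ∘ₗ N.subtype ∘ₗ p) (f ∘ₗ D.subtype ∘ₗ q) - pairing φ f =
            pairing (φ ∘ₗ N.subtype ∘ₗ p - φ) (f ∘ₗ D.subtype ∘ₗ q) +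
              pairing φ (f ∘ₗ D.subtype ∘ₗ q - f) := by
          ext m c
          simp only [TensorProduct.AlgebraTensorModule.curry_apply, TensorProduct.curry_apply,
            LinearMap.restrictScalars_apply, LinearMap.sub_apply, LinearMap.add_apply, pairing_tmul]
          ring
        have key' := LinearMap.congr_fun key t
        rw [LinearMap.add_apply, h1, h2, add_zero] at key'
        exact key'
      · rw [Submodule.mem_dualAnnihilator]
        intro c hc
        have := LinearMap.congr_fun hq ⟨c, hc⟩
        simp at this
        simp [this]
    · rw [Submodule.mem_dualAnnihilator]
      intro c hc
      have := LinearMap.congr_fun hp ⟨c, hc⟩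
      simp at this
      simp [this]

theorem mem_of_forall_dualAnnihilator {N : Submodule k M} {x : M}
    (h : ∀ φ ∈ N.dualAnnihilator, φ x = 0) : x ∈ N :=
  (Subspace.forall_mem_dualAnnihilator_apply_eq_zero_iff N x).1 h

end Pairing

/-! ### Subcoalgebras and wedges through the convolution algebra. -/

section Coalgebras

variable {k : Type u} {C : Type v} [Field k] [AddCommGroup C] [Module k C] [Coalgebra k C]

/-- The convolution product of functionals. -/
noncomputable def conv (f g : Module.Dual k C) : Module.Dual k C :=
  (WithConv.toConv f * WithConv.toConv g).ofConv

theorem conv_apply (f g : Module.Dual k C) (c : C) :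
    conv f g c = pairing f g (comul (R := k) c) := rfl

/-- Subcoalgebras are the subspaces whose annihilator is a two-sided ideal of `C^*`. -/
theorem isSubcoalgebra_iff {D : Submodule k C} :
    IsSubcoalgebra D ↔ ∀ f ∈ D.dualAnnihilator, ∀ g,
      conv f g ∈ D.dualAnnihilator ∧ conv g f ∈ D.dualAnnihilator := by
  simp only [IsSubcoalgebra, mem_range_mapIncl_iff, Submodule.mem_dualAnnihilator, conv_apply]
  constructor
  · exact fun h f hf g => ⟨fun c hc => h c hc f g (.inl hf), fun c hc => h c hc g f (.inr hf)⟩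
  · rintro h c hc f g (hf | hf)
    exacts [(h f hf g).1 c hc, (h g hf f).2 c hc]

theorem isSubcoalgebra_sSup {S : Set (Submodule k C)} (h : ∀ D ∈ S, IsSubcoalgebra D) :
    IsSubcoalgebra (sSup S) := by
  have : sSup S ≤ (LinearMap.range (TensorProduct.mapIncl (sSup S) (sSup S))).comap
      (comul (R := k)) := by
    refine sSup_le fun D hD c hc => ?_
    have := h D hD c hc
    rw [mem_range_mapIncl_iff] at this
    rw [Submodule.mem_comap, mem_range_mapIncl_iff]
    exact fun f g hfg => this f g (hfg.imp (fun h => Submodule.dualAnnihilator_anti (le_sSup hD) h)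
      (fun h => Submodule.dualAnnihilator_anti (le_sSup hD) h))
  exact this

theorem IsSubcoalgebra.inf {D E : Submodule k C} (hD : IsSubcoalgebra D) (hE : IsSubcoalgebra E) :
    IsSubcoalgebra (D ⊓ E) := by
  rw [isSubcoalgebra_iff] at *
  intro f hf g
  -- Over a field the annihilator of an intersection is the sum of the annihilators, and a sum of
  -- ideals is an ideal.
  rw [Subspace.dualAnnihilator_inf_eq] at *
  simp only [Submodule.mem_sup] at *
  obtain ⟨a, ha, b, hb, rfl⟩ := hf
  have h1 : conv (a + b) g = conv a g + conv b g :=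
    congrArg WithConv.ofConv (add_mul (WithConv.toConv a) (WithConv.toConv b) (WithConv.toConv g))
  have h2 : conv g (a + b) = conv g a + conv g b :=
    congrArg WithConv.ofConv (mul_add (WithConv.toConv g) (WithConv.toConv a) (WithConv.toConv b))
  exact ⟨⟨_, (hD a ha g).1, _, (hE b hb g).1, h1.symm⟩, ⟨_, (hD a ha g).2, _, (hE b hb g).2, h2.symm⟩⟩

theorem mem_coalgebraWedge_iff {X Y : Submodule k C} {c : C} :
    c ∈ coalgebraWedge X Y ↔
      ∀ f ∈ X.dualAnnihilator, ∀ g ∈ Y.dualAnnihilator, conv f g c = 0 := by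
  rw [coalgebraWedge, LinearMap.mem_ker, LinearMap.comp_apply]
  constructor
  · intro h f hf g hg
    have := pairing_map X.mkQ Y.mkQ (X.liftQ f ((Submodule.mem_dualAnnihilator f).1 hf))
      (Y.liftQ g ((Submodule.mem_dualAnnihilator g).1 hg)) (comul (R := k) c)
    rw [h, map_zero] at this
    exact this.symm
  · intro h
    apply eq_zero_of_forall_pairing
    intro f g
    rw [pairing_map]
    refine h _ ?_ _ ?_ <;> rw [Submodule.mem_dualAnnihilator] <;> intro x hx
    · exact (congrArg f ((Submodule.Quotient.mk_eq_zero X).2 hx)).trans (map_zero f)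
    · exact (congrArg g ((Submodule.Quotient.mk_eq_zero Y).2 hx)).trans (map_zero g)

end Coalgebras

/-! ### The Galois connection between `coeffSpace` and `coeffIn`. -/

section Comodules

variable {k : Type u} {C : Type v} {M : Type w} [Field k] [AddCommGroup C] [Module k C]
  [Coalgebra k C] [AddCommGroup M] [Module k M] [RightComodule k C M]

theorem act_counit (x : M) : act M (counit (R := k) (A := C)) x = x := by
  have := LinearMap.congr_fun (RightComodule.coact_counit (k := k) (C := C) (M := M)) x
  rw [LinearMap.comp_apply] at this
  simp [act, this]

theorem act_conv (f g : Module.Dual k C) (x : M) : act M (conv f g) x = act M f (act M g x) := by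
  have key := LinearMap.congr_fun (RightComodule.coact_coassoc (k := k) (C := C) (M := M)) x
  simp only [LinearMap.comp_apply, LinearEquiv.coe_coe] at key
  have h1 : act M (conv f g) x = TensorProduct.rid k M ((pairing f g).lTensor M
      ((comul (R := k) (A := C)).lTensor M (RightComodule.coact x))) := by
    rw [← LinearMap.comp_apply (LinearMap.lTensor M (pairing f g)), ← LinearMap.lTensor_comp]
    rfl
  rw [h1, ← key]
  simp only [act, LinearMap.comp_apply, LinearEquiv.coe_coe]
  generalize (RightComodule.coact x : M ⊗[k] C) = t
  induction t with
  | zero => simp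
  | add y z hy hz => simp only [map_add, hy, hz]
  | tmul m c =>
    simp only [LinearMap.rTensor_tmul, LinearMap.lTensor_tmul, TensorProduct.rid_tmul, map_smul]
    generalize (RightComodule.coact m : M ⊗[k] C) = s
    induction s with
    | zero => simp
    | add y z hy hz => simp only [map_add, TensorProduct.add_tmul, smul_add, hy, hz]
    | tmul m' c' => simp [pairing_tmul, smul_smul, mul_comm]

theorem apply_act (φ : Module.Dual k M) (f : Module.Dual k C) (x : M) :
    φ (act M f x) = pairing φ f (RightComodule.coact x) := by
  simp only [act, LinearMap.comp_apply, LinearEquiv.coe_coe]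
  generalize (RightComodule.coact x : M ⊗[k] C) = t
  induction t with
  | zero => simp
  | add y z hy hz => simp only [map_add, hy, hz]
  | tmul m c => simp [pairing_tmul, mul_comm]

theorem act_add_left (f g : Module.Dual k C) (x : M) :
    act M (f + g) x = act M f x + act M g x := by
  simp [act, LinearMap.lTensor_add]

theorem act_smul_left (a : k) (f : Module.Dual k C) (x : M) : act M (a • f) x = a • act M f x := by
  simp [act, LinearMap.lTensor_smul]

/-- Subcomodules are the same as `C^*`-submodules, so coactions can be forgotten from here on. -/
theorem isSubcomodule_iff {N : Submodule k M} :
    IsSubcomodule C N ↔ ∀ x ∈ N, ∀ f : Module.Dual k C, act M f x ∈ N := by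
  have h : LinearMap.range (N.subtype.rTensor C) =
      LinearMap.range (TensorProduct.mapIncl N (⊤ : Submodule k C)) := by
    apply le_antisymm
    · have : N.subtype.rTensor C = TensorProduct.mapIncl N (⊤ : Submodule k C) ∘ₗ
          TensorProduct.map LinearMap.id (Submodule.topEquiv (R := k) (M := C)).symm.toLinearMap := by
        ext; simp [TensorProduct.mapIncl]
      rw [this]
      exact LinearMap.range_comp_le_range _ _
    · have : TensorProduct.mapIncl N (⊤ : Submodule k C) = N.subtype.rTensor C ∘ₗ
          TensorProduct.map LinearMap.id (Submodule.subtype ⊤) := by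
        ext; simp [TensorProduct.mapIncl]
      rw [this]
      exact LinearMap.range_comp_le_range _ _
  refine forall₂_congr fun x _ => ?_
  rw [h, mem_range_mapIncl_iff]
  constructor
  · intro h f
    exact mem_of_forall_dualAnnihilator fun φ hφ => by rw [apply_act, h φ f (.inl hφ)]
  · rintro h φ f (hφ | hf)
    · rw [← apply_act]
      exact (Submodule.mem_dualAnnihilator φ).1 hφ _ (h f)
    · rw [Submodule.dualAnnihilator_top, Submodule.mem_bot] at hf
      simp [hf, pairing]

/-- The coefficient `∑ φ(x₍₀₎) x₍₁₎`. -/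
noncomputable def coeff (φ : Module.Dual k M) : M →ₗ[k] C :=
  (TensorProduct.lid k C).toLinearMap ∘ₗ φ.rTensor C ∘ₗ RightComodule.coact

theorem apply_coeff (φ : Module.Dual k M) (f : Module.Dual k C) (x : M) :
    f (coeff φ x) = φ (act M f x) := by
  rw [apply_act]
  simp only [coeff, LinearMap.comp_apply, LinearEquiv.coe_coe]
  generalize (RightComodule.coact x : M ⊗[k] C) = t
  induction t with
  | zero => simp
  | add y z hy hz => simp only [map_add, hy, hz]
  | tmul m c => simp [pairing_tmul]

variable (C) in
/-- The span of the coefficients of the elements of `N`. -/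
noncomputable def coeffSpace (N : Submodule k M) : Submodule k C :=
  Submodule.span k {c | ∃ φ : Module.Dual k M, ∃ x ∈ N, coeff φ x = c}

theorem coeff_mem_coeffSpace {N : Submodule k M} (φ : Module.Dual k M) {x : M} (hx : x ∈ N) :
    coeff φ x ∈ coeffSpace C N :=
  Submodule.subset_span ⟨φ, x, hx, rfl⟩

theorem act_eq_zero_iff {f : Module.Dual k C} {x : M} :
    act M f x = 0 ↔ ∀ φ : Module.Dual k M, f (coeff φ x) = 0 := by
  simp only [apply_coeff, Module.forall_dual_apply_eq_zero_iff]

theorem annDual_eq (N : Submodule k M) :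
    annDual C N = ((coeffSpace C N).dualAnnihilator : Set (Module.Dual k C)) := by
  ext f
  rw [SetLike.mem_coe, Submodule.mem_dualAnnihilator]
  constructor
  · intro h c hc
    induction hc using Submodule.span_induction with
    | mem c hc =>
      obtain ⟨φ, x, hx, rfl⟩ := hc
      exact act_eq_zero_iff.1 (h x hx) φ
    | zero => simp
    | add _ _ _ _ h1 h2 => rw [map_add, h1, h2, add_zero]
    | smul a _ _ h1 => rw [map_smul, h1, smul_zero]
  · exact fun h x hx => act_eq_zero_iff.2 fun φ => h _ (coeff_mem_coeffSpace φ hx)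

/-- The annihilator in `C^*` of a `C^*`-module is a two-sided ideal. -/
theorem IsSubcomodule.isSubcoalgebra_coeffSpace {N : Submodule k M} (hN : IsSubcomodule C N) :
    IsSubcoalgebra (coeffSpace C N) := by
  rw [isSubcoalgebra_iff]
  intro f hf g
  simp only [← SetLike.mem_coe, ← annDual_eq] at *
  rw [isSubcomodule_iff] at hN
  refine ⟨fun x hx => ?_, fun x hx => ?_⟩
  · rw [act_conv, hf _ (hN x hx g)]
  · rw [act_conv, hf x hx, map_zero]

variable (M) in
/-- The elements of `M` all of whose coefficients lie in `D`. -/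
def coeffIn (D : Submodule k C) : Submodule k M :=
  annComodule M (D.dualAnnihilator : Set (Module.Dual k C))

theorem mem_coeffIn_iff {D : Submodule k C} {x : M} :
    x ∈ coeffIn M D ↔ ∀ φ : Module.Dual k M, coeff φ x ∈ D := by
  constructor
  · exact fun h φ => mem_of_forall_dualAnnihilator fun f hf => act_eq_zero_iff.1 (h f hf) φ
  · exact fun h f hf => act_eq_zero_iff.2 fun φ => (Submodule.mem_dualAnnihilator f).1 hf _ (h φ)

theorem coeffSpace_le_iff {N : Submodule k M} {D : Submodule k C} :
    coeffSpace C N ≤ D ↔ N ≤ coeffIn M D := by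
  rw [coeffSpace, Submodule.span_le]
  constructor
  · exact fun h x hx => mem_coeffIn_iff.2 fun φ => h ⟨φ, x, hx, rfl⟩
  · rintro h _ ⟨φ, x, hx, rfl⟩
    exact mem_coeffIn_iff.1 (h hx) φ

theorem coeffSpace_coeffIn_le (D : Submodule k C) : coeffSpace C (coeffIn M D) ≤ D :=
  coeffSpace_le_iff.2 le_rfl

theorem le_coeffIn_coeffSpace (N : Submodule k M) : N ≤ coeffIn M (coeffSpace C N) :=
  coeffSpace_le_iff.1 le_rfl

theorem coeffIn_mono {D E : Submodule k C} (h : D ≤ E) : coeffIn M D ≤ coeffIn M E :=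
  coeffSpace_le_iff.1 ((coeffSpace_coeffIn_le D).trans h)

theorem coeffSpace_mono {N L : Submodule k M} (h : N ≤ L) : coeffSpace C N ≤ coeffSpace C L :=
  coeffSpace_le_iff.2 (h.trans (le_coeffIn_coeffSpace L))

theorem comoduleClosure_eq (N : Submodule k M) :
    comoduleClosure C N = coeffIn M (coeffSpace C N) := by
  rw [comoduleClosure, annDual_eq, coeffIn]

theorem coeffIn_inf (D E : Submodule k C) : coeffIn M (D ⊓ E) = coeffIn M D ⊓ coeffIn M E := by
  ext x
  simp only [Submodule.mem_inf, mem_coeffIn_iff, forall_and]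

/-- The counit acts as the identity, so an element without nonzero coefficients is zero. -/
theorem coeffIn_bot : coeffIn M (⊥ : Submodule k C) = ⊥ := by
  refine (Submodule.eq_bot_iff _).2 fun x hx => ?_
  rw [← act_counit (k := k) (C := C) x]
  exact hx _ (by simp)

theorem isSubcomodule_coeffIn {D : Submodule k C} (hD : IsSubcoalgebra D) :
    IsSubcomodule C (coeffIn M D) := by
  rw [isSubcomodule_iff]
  intro x hx f g hg
  rw [← act_conv]
  exact hx _ (isSubcoalgebra_iff.1 hD g hg f).1

theorem isClosedSubcomodule_coeffIn {D : Submodule k C} (hD : IsSubcoalgebra D) :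
    IsClosedSubcomodule C (coeffIn M D) := by
  refine ⟨isSubcomodule_coeffIn hD, ?_⟩
  rw [comoduleClosure_eq]
  exact le_antisymm (coeffIn_mono (coeffSpace_coeffIn_le D)) (le_coeffIn_coeffSpace _)

theorem IsClosedSubcomodule.eq_coeffIn {N : Submodule k M} (hN : IsClosedSubcomodule C N) :
    N = coeffIn M (coeffSpace C N) := by
  rw [← comoduleClosure_eq, hN.2]

theorem coeffSpace_ne_bot {N : Submodule k M} (hN : N ≠ ⊥) : coeffSpace C N ≠ ⊥ := by
  intro h
  apply hN
  rw [eq_bot_iff, ← coeffIn_bot (k := k) (C := C), ← h]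
  exact le_coeffIn_coeffSpace N

theorem IsClosedSubcomodule.isWeakClosedSubcomodule {N : Submodule k M}
    (hN : IsClosedSubcomodule C N) : IsWeakClosedSubcomodule C N := by
  refine ⟨hN.1, fun x hx => ?_⟩
  rw [hN.eq_coeffIn, comoduleClosure_eq]
  refine coeffIn_mono (coeffSpace_mono (Submodule.span_le.2 ?_))
  rintro _ ⟨f, rfl⟩
  exact isSubcomodule_iff.1 hN.1 x hx f

theorem component_eq_coeffIn {D : Submodule k C} (hD : IsSubcoalgebra D) :
    component M D = coeffIn M D := by
  apply le_antisymm
  · refine sSup_le fun N hN x hx f hf => ?_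
    rw [← Module.forall_dual_apply_eq_zero_iff k]
    intro φ
    rw [apply_act]
    exact mem_range_mapIncl_iff.1 (hN.2 x hx) φ f (.inr hf)
  · refine le_sSup ⟨isSubcomodule_coeffIn hD, fun x hx => mem_range_mapIncl_iff.2 ?_⟩
    rintro φ f (hφ | hf) <;> rw [← apply_act]
    · exact (Submodule.mem_dualAnnihilator φ).1 hφ _
        (isSubcomodule_iff.1 (isSubcomodule_coeffIn hD) x hx f)
    · rw [hx f hf, map_zero]

theorem comoduleWedge_eq (N L : Submodule k M) :
    comoduleWedge C N L = coeffIn M (coalgebraWedge (coeffSpace C N) (coeffSpace C L)) := by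
  ext x
  rw [mem_coeffIn_iff]
  simp only [mem_coalgebraWedge_iff, comoduleWedge, annDual_eq]
  constructor
  · exact fun h φ f hf g hg => act_eq_zero_iff.1 (h _ ⟨f, hf, g, hg, rfl⟩) φ
  · rintro h _ ⟨f, hf, g, hg, rfl⟩
    exact act_eq_zero_iff.2 fun φ => h φ f hf g hg

end Comodules

section

variable {k : Type u} {C : Type v} {M : Type w} [Field k] [AddCommGroup C] [Module k C]
  [Coalgebra k C] [AddCommGroup M] [Module k M]

/-! ### The coalgebra as a comodule over itself. -/

section Regular

/-- The regular comodule structure, transported along a linear equivalence with `C`. -/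
@[reducible] noncomputable def comoduleOfEquiv (e : M ≃ₗ[k] C) : RightComodule k C M where
  coact := e.symm.toLinearMap.rTensor C ∘ₗ comul ∘ₗ e.toLinearMap
  coact_coassoc := by
    ext x
    simp only [LinearMap.comp_apply, LinearEquiv.coe_coe]
    generalize e x = c
    have h1 : ∀ t : C ⊗[k] C, (e.symm.toLinearMap.rTensor C ∘ₗ comul ∘ₗ e.toLinearMap).rTensor C
        (e.symm.toLinearMap.rTensor C t) =
          (e.symm.toLinearMap.rTensor C).rTensor C ((comul (R := k)).rTensor C t) := by
      intro t
      rw [← LinearMap.comp_apply, ← LinearMap.comp_apply, ← LinearMap.rTensor_comp,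
        ← LinearMap.rTensor_comp]
      congr 2
      ext y
      simp
    have h2 : ∀ t : (C ⊗[k] C) ⊗[k] C, TensorProduct.assoc k M C C
        ((e.symm.toLinearMap.rTensor C).rTensor C t) =
          e.symm.toLinearMap.rTensor (C ⊗[k] C) (TensorProduct.assoc k C C C t) := by
      intro t
      rw [← LinearEquiv.coe_coe, ← LinearMap.comp_apply, ← LinearEquiv.coe_coe (TensorProduct.assoc
        k C C C), ← LinearMap.comp_apply]
      congr 1
      ext
      simp
    rw [h1, h2, Coalgebra.coassoc_apply, ← LinearMap.comp_apply, LinearMap.rTensor_comp_lTensor,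
      ← LinearMap.lTensor_comp_rTensor]
    rfl
  coact_counit := by
    ext x
    simp only [LinearMap.comp_apply, LinearEquiv.coe_coe]
    rw [← LinearMap.comp_apply, LinearMap.lTensor_comp_rTensor, ← LinearMap.rTensor_comp_lTensor,
      LinearMap.comp_apply, Coalgebra.lTensor_counit_comul]
    simp

theorem apply_act_comoduleOfEquiv (e : M ≃ₗ[k] C) (f g : Module.Dual k C) (x : M) :
    letI := comoduleOfEquiv e
    g (e (act M f x)) = conv g f (e x) := by
  let := comoduleOfEquiv e
  have h := apply_act (g ∘ₗ e.toLinearMap) f x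
  have h2 := pairing_map e.symm.toLinearMap LinearMap.id (g ∘ₗ e.toLinearMap) f
    (comul (R := k) (e x))
  refine h.trans (h2.trans ?_)
  rw [conv_apply]
  congr 2
  ext
  simp

theorem coeffSpace_comoduleOfEquiv_le (e : M ≃ₗ[k] C) {D : Submodule k C} (hD : IsSubcoalgebra D) :
    letI := comoduleOfEquiv e
    coeffSpace C (D.comap e.toLinearMap) ≤ D := by
  let := comoduleOfEquiv e
  rw [coeffSpace_le_iff]
  intro x hx f hf
  apply e.injective
  rw [map_zero, ← Module.forall_dual_apply_eq_zero_iff k]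
  intro g
  rw [apply_act_comoduleOfEquiv]
  exact (Submodule.mem_dualAnnihilator _).1 (isSubcoalgebra_iff.1 hD f hf g).2 _ hx

theorem isSubcomodule_comap_comoduleOfEquiv (e : M ≃ₗ[k] C) {D : Submodule k C}
    (hD : IsSubcoalgebra D) :
    letI := comoduleOfEquiv e
    IsSubcomodule C (D.comap e.toLinearMap) := by
  let := comoduleOfEquiv e
  rw [isSubcomodule_iff]
  intro x hx f
  refine mem_of_forall_dualAnnihilator (N := D) fun g hg => ?_
  refine (apply_act_comoduleOfEquiv e f g x).trans ?_
  exact (Submodule.mem_dualAnnihilator _).1 (isSubcoalgebra_iff.1 hD g hg f).1 _ hx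

end Regular

/-! ### Coefficients of simple comodules; local finiteness. -/

section Simple

variable [RightComodule k C M]

theorem mem_cyclic_iff {x y : M} :
    y ∈ cyclic (k := k) C x ↔ ∃ g : Module.Dual k C, act M g x = y := by
  refine ⟨fun hy => ?_, fun hy => Submodule.subset_span hy⟩
  induction hy using Submodule.span_induction with
  | mem y hy => exact hy
  | zero => exact ⟨0, by simp [act]⟩
  | add _ _ _ _ h1 h2 =>
    obtain ⟨f, rfl⟩ := h1
    obtain ⟨g, rfl⟩ := h2
    exact ⟨f + g, act_add_left f g _⟩
  | smul a _ _ h1 =>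
    obtain ⟨f, rfl⟩ := h1
    exact ⟨a • f, act_smul_left a f _⟩

theorem self_mem_cyclic (x : M) : x ∈ cyclic (k := k) C x :=
  mem_cyclic_iff.2 ⟨counit, act_counit x⟩

theorem isSubcomodule_cyclic (x : M) : IsSubcomodule C (cyclic (k := k) C x) := by
  rw [isSubcomodule_iff]
  intro y hy f
  obtain ⟨g, rfl⟩ := mem_cyclic_iff.1 hy
  exact mem_cyclic_iff.2 ⟨conv f g, act_conv f g x⟩

theorem cyclic_le {N : Submodule k M} (hN : IsSubcomodule C N) {x : M} (hx : x ∈ N) :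
    cyclic (k := k) C x ≤ N := by
  intro y hy
  obtain ⟨g, rfl⟩ := mem_cyclic_iff.1 hy
  exact isSubcomodule_iff.1 hN x hx g

/-- Induction on the number of terms of a nonzero sum of coefficients `e ∈ E`: either acting by some
`f` shortens the sum, or `S` embeds in `E` by `g · s₀ ↦ g · e`, and then its coefficients lie in
`E`. -/
theorem coeffSpace_le_of_ne_zero {S : Submodule k M} (hS : IsSubcomodule C S)
    (hmin : ∀ L ≤ S, IsSubcomodule C L → L ≠ ⊥ → L = S) {E : Submodule k C}
    (hE : IsSubcoalgebra E) (n : ℕ) : ∀ (φ : Fin n → Module.Dual k M) (s : Fin n → M),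
    (∀ i, s i ∈ S) → ∑ i, coeff (φ i) (s i) ∈ E → ∑ i, coeff (C := C) (φ i) (s i) ≠ 0 →
      coeffSpace C S ≤ E := by
  let : RightComodule k C C := comoduleOfEquiv (LinearEquiv.refl k C)
  have hact : ∀ (f g : Module.Dual k C) (c : C), g (act C f c) = conv g f c :=
    apply_act_comoduleOfEquiv (LinearEquiv.refl k C)
  -- Each `coeff φ` is `C^*`-linear from `M` to the regular comodule.
  have hcoeff : ∀ (f : Module.Dual k C) (φ : Module.Dual k M) (x : M),
      act C f (coeff φ x) = coeff φ (act M f x) := by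
    intro f φ x
    rw [← sub_eq_zero, ← Module.forall_dual_apply_eq_zero_iff k]
    intro g
    rw [map_sub, hact, apply_coeff, apply_coeff, act_conv, sub_self]
  have hEC : ∀ (f : Module.Dual k C), ∀ e ∈ E, act C f e ∈ E := fun f e he =>
    mem_of_forall_dualAnnihilator fun g hg => by
      rw [hact]
      exact (Submodule.mem_dualAnnihilator _).1 (isSubcoalgebra_iff.1 hE g hg f).1 _ he
  have hE0 : ∀ f ∈ E.dualAnnihilator, ∀ e ∈ E, act C f e = 0 := fun f hf e he => by
    rw [← Module.forall_dual_apply_eq_zero_iff k]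
    intro g
    rw [hact]
    exact (Submodule.mem_dualAnnihilator _).1 (isSubcoalgebra_iff.1 hE f hf g).2 _ he
  rw [isSubcomodule_iff] at hS
  induction n with
  | zero => intro φ s _ _ h; simp at h
  | succ n ih =>
    intro φ s hs he he0
    by_cases h : ∃ f : Module.Dual k C, act M f (s 0) = 0 ∧
        act C f (∑ i, coeff (C := C) (φ i) (s i)) ≠ 0
    · obtain ⟨f, hf0, hf⟩ := h
      have key : ∑ i : Fin n, coeff (φ i.succ) (act M f (s i.succ)) =
          act C f (∑ i, coeff (φ i) (s i)) := by
        rw [map_sum, Fin.sum_univ_succ]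
        simp only [hcoeff, hf0, map_zero, zero_add]
      refine ih (fun i => φ i.succ) (fun i => act M f (s i.succ)) (fun i => hS _ (hs _) f) ?_ ?_
      · rw [key]; exact hEC f _ he
      · rw [key]; exact hf
    · push Not at h
      set e := ∑ i, coeff (C := C) (φ i) (s i)
      clear_value e
      -- By `h`, `g · s₀ ↦ g · e` is well defined on `C^* · s₀`; `Z` is its kernel. If `Z = S`, some
      -- `g` fixes `s₀` and kills `e`; then `ε - g` kills `s₀`, hence `e`, which forces `e = 0`.
      let Z : Submodule k M :=
        { carrier := {x | ∃ g : Module.Dual k C, act M g (s 0) = x ∧ act C g e = 0}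
          add_mem' := by
            rintro _ _ ⟨f, rfl, hf⟩ ⟨g, rfl, hg⟩
            exact ⟨f + g, act_add_left f g _, by rw [act_add_left, hf, hg, add_zero]⟩
          zero_mem' := ⟨0, by simp [act], by simp [act]⟩
          smul_mem' := by
            rintro a _ ⟨f, rfl, hf⟩
            exact ⟨a • f, act_smul_left a f _, by rw [act_smul_left, hf, smul_zero]⟩ }
      have hZS : Z ≤ S := by
        rintro _ ⟨g, rfl, -⟩
        exact hS _ (hs 0) g
      have hZ : IsSubcomodule C Z := by
        rw [isSubcomodule_iff]
        rintro _ ⟨g, rfl, hg⟩ f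
        exact ⟨conv f g, act_conv f g _, by rw [act_conv, hg, map_zero]⟩
      have hZ0 : Z = ⊥ := by
        by_contra hne
        have hmem : s 0 ∈ Z := hmin Z hZS hZ hne ▸ hs 0
        obtain ⟨g, hg, hge⟩ := hmem
        have h1 := h (counit + (-1 : k) • g) (by
          rw [act_add_left, act_smul_left, act_counit, hg]; simp)
        rw [act_add_left, act_smul_left, act_counit, hge, smul_zero, add_zero] at h1
        exact he0 h1
      have hWS : cyclic (k := k) C (s 0) = S := by
        refine hmin _ (cyclic_le (isSubcomodule_iff.2 hS) (hs 0)) (isSubcomodule_cyclic _) ?_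
        intro hbot
        have h0 : s 0 = 0 := by
          rw [← Submodule.mem_bot k, ← hbot]
          exact self_mem_cyclic _
        have h1 := h counit (by rw [h0, map_zero])
        rw [act_counit] at h1
        exact he0 h1
      rw [coeffSpace_le_iff, ← hWS]
      intro x hx f hf
      obtain ⟨g, rfl⟩ := mem_cyclic_iff.1 hx
      -- The image `g · e` lies in `E`, so `f` kills it; injectivity gives `f · (g · s₀) = 0`.
      rw [← act_conv, ← Submodule.mem_bot k, ← hZ0]
      exact ⟨_, rfl, by rw [act_conv]; exact hE0 f hf _ (hEC g e he)⟩

theorem isSimpleSubcoalgebra_coeffSpace {S : Submodule k M} (hS : IsSubcomodule C S)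
    (hmin : ∀ L ≤ S, IsSubcomodule C L → L ≠ ⊥ → L = S) : IsSimpleSubcoalgebra (coeffSpace C S) := by
  refine ⟨hS.isSubcoalgebra_coeffSpace, fun E hE hE0 hle => le_antisymm hle ?_⟩
  obtain ⟨e, he, he0⟩ := Submodule.exists_mem_ne_zero_of_ne_bot hE0
  obtain ⟨n, a, g, rfl⟩ := Submodule.mem_span_set'.1 (hle he)
  choose φ s hs hφ using fun i => (g i).2
  have key : ∑ i, a i • (g i : C) = ∑ i, coeff (φ i) (a i • s i) := by
    simp only [map_smul, hφ]
  rw [key] at he he0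
  exact coeffSpace_le_of_ne_zero hS hmin hE n φ (fun i => a i • s i)
    (fun i => S.smul_mem _ (hs i)) he he0

/-- The left tensor factors in an expression of `ρ(x)` are finitely many and span a space containing
`C^* · x`. -/
theorem finiteDimensional_cyclic (x : M) : FiniteDimensional k (cyclic (k := k) C x) := by
  have key : ∀ t : M ⊗[k] C, ∃ F : Submodule k M, F.FG ∧
      ∀ f : Module.Dual k C, TensorProduct.rid k M (f.lTensor M t) ∈ F := by
    intro t
    induction t with
    | zero => exact ⟨⊥, Submodule.fg_bot, by simp⟩
    | add y z hy hz =>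
      obtain ⟨F, hF, h1⟩ := hy
      obtain ⟨G, hG, h2⟩ := hz
      refine ⟨F ⊔ G, hF.sup hG, fun f => ?_⟩
      rw [map_add, map_add]
      exact Submodule.add_mem_sup (h1 f) (h2 f)
    | tmul m c =>
      refine ⟨Submodule.span k {m}, Submodule.fg_span_singleton m, fun f => ?_⟩
      simpa using Submodule.smul_mem _ _ (Submodule.mem_span_singleton_self m)
  obtain ⟨F, hF, h⟩ := key (RightComodule.coact x)
  have : FiniteDimensional k F := Module.Finite.iff_fg.2 hF
  refine Submodule.finiteDimensional_of_le (S₂ := F) (Submodule.span_le.2 ?_)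
  rintro _ ⟨f, rfl⟩
  exact h f

end Simple

end

section

variable {k : Type u} {C : Type v} {M : Type w} [Field k] [AddCommGroup C] [Module k C]
  [Coalgebra k C] [AddCommGroup M] [Module k M]

/-! ### Minimal closed subcomodules versus simple subcoalgebras. -/

section Minimal

variable [RightComodule k C M]

theorem exists_minimal_subcomodule {N : Submodule k M} (hN : IsSubcomodule C N) (h0 : N ≠ ⊥) :
    ∃ S ≤ N, IsSubcomodule C S ∧ S ≠ ⊥ ∧ ∀ L ≤ S, IsSubcomodule C L → L ≠ ⊥ → L = S := by
  classical
  have hex : ∃ n, ∃ S ≤ N, IsSubcomodule C S ∧ S ≠ ⊥ ∧ FiniteDimensional k S ∧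
      Module.finrank k S = n := by
    obtain ⟨x, hx, hx0⟩ := Submodule.exists_mem_ne_zero_of_ne_bot h0
    exact ⟨_, cyclic C x, cyclic_le hN hx, isSubcomodule_cyclic x,
      Submodule.ne_bot_iff _ |>.2 ⟨x, self_mem_cyclic x, hx0⟩, finiteDimensional_cyclic x, rfl⟩
  obtain ⟨S, hSN, hS, hS0, hfin, hrank⟩ := Nat.find_spec hex
  refine ⟨S, hSN, hS, hS0, fun L hLS hL hL0 => ?_⟩
  refine Submodule.eq_of_le_of_finrank_le hLS ?_
  rw [hrank]
  exact Nat.find_min' hex ⟨L, hLS.trans hSN, hL, hL0, Submodule.finiteDimensional_of_le hLS, rfl⟩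

theorem exists_isSimpleSubcoalgebra {N : Submodule k M} (hN : IsSubcomodule C N) (h0 : N ≠ ⊥) :
    ∃ D : Submodule k C, IsSimpleSubcoalgebra D ∧ D ≠ ⊥ ∧ D ≤ coeffSpace C N ∧
      coeffIn M D ≠ ⊥ := by
  obtain ⟨S, hSN, hS, hS0, hmin⟩ := exists_minimal_subcomodule hN h0
  refine ⟨coeffSpace C S, isSimpleSubcoalgebra_coeffSpace hS hmin, coeffSpace_ne_bot hS0,
    coeffSpace_mono hSN, fun h => hS0 ?_⟩
  rw [eq_bot_iff, ← h]
  exact le_coeffIn_coeffSpace S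

theorem isMinimalClosedSubcomodule_coeffIn {D : Submodule k C} (hD : IsSimpleSubcoalgebra D) :
    IsMinimalClosedSubcomodule C (coeffIn M D) := by
  refine ⟨isClosedSubcomodule_coeffIn hD.1, fun L hL hL0 hle => ?_⟩
  rw [hL.eq_coeffIn, hD.2 _ hL.1.isSubcoalgebra_coeffSpace (coeffSpace_ne_bot hL0)
    (coeffSpace_le_iff.2 hle)]

theorem IsMinimalClosedSubcomodule.isSimpleSubcoalgebra_coeffSpace {N : Submodule k M}
    (hN : IsMinimalClosedSubcomodule C N) : IsSimpleSubcoalgebra (coeffSpace C N) := by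
  by_cases h0 : N = ⊥
  · refine ⟨hN.1.1.isSubcoalgebra_coeffSpace, fun E _ hE0 hle => (hE0 ?_).elim⟩
    rw [eq_bot_iff]
    refine hle.trans (coeffSpace_le_iff.2 ?_)
    rw [h0]
    exact bot_le
  · obtain ⟨D, hD, -, hDN, hD'⟩ := exists_isSimpleSubcoalgebra hN.1.1 h0
    have h1 : coeffIn M D = N := by
      refine hN.2 _ (isClosedSubcomodule_coeffIn hD.1) hD' ?_
      conv_rhs => rw [hN.1.eq_coeffIn]
      exact coeffIn_mono hDN
    have h2 : coeffSpace C N = D := le_antisymm (h1 ▸ coeffSpace_coeffIn_le D) hDN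
    rwa [h2]

/-- An irreducible `D` contains only one nonzero simple subcoalgebra: two of them meet nontrivially,
so both equal their intersection. -/
theorem isRelativeIrreducibleSubcomodule_coeffIn {D : Submodule k C}
    (hD : IsIrreducibleSubcoalgebra D) (h0 : coeffIn M D ≠ ⊥) :
    IsRelativeIrreducibleSubcomodule C (coeffIn M D) := by
  have hsub := isSubcomodule_coeffIn (M := M) hD.1
  obtain ⟨E, hE, hE0, hle, hE'⟩ := exists_isSimpleSubcoalgebra hsub h0
  have hED : E ≤ D := hle.trans (coeffSpace_coeffIn_le D)
  refine ⟨hsub, coeffIn M E, ⟨isMinimalClosedSubcomodule_coeffIn hE, hE', coeffIn_mono hED⟩, ?_⟩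
  rintro P ⟨hP, hP0, hPD⟩
  have hPD' := coeffSpace_le_iff.2 hPD
  have hPs := hP.isSimpleSubcoalgebra_coeffSpace
  have hinf := hD.2.2 E (coeffSpace C P) hE.1 hPs.1 hED hPD' hE0 (coeffSpace_ne_bot hP0)
  have hsubco := hE.1.inf hPs.1
  rw [hP.1.eq_coeffIn, ← hPs.2 _ hsubco hinf inf_le_right, hE.2 _ hsubco hinf inf_le_left]

end Minimal

theorem IsSubcoalgebra.exists_isSimpleSubcoalgebra_le {D : Submodule k C} (hD : IsSubcoalgebra D)
    (h0 : D ≠ ⊥) : ∃ E ≤ D, IsSimpleSubcoalgebra E ∧ E ≠ ⊥ := by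
  let := comoduleOfEquiv (LinearEquiv.refl k C)
  obtain ⟨E, hE, hE0, hle, -⟩ := exists_isSimpleSubcoalgebra
    (isSubcomodule_comap_comoduleOfEquiv (LinearEquiv.refl k C) hD) h0
  exact ⟨E, hle.trans (coeffSpace_comoduleOfEquiv_le (LinearEquiv.refl k C) hD), hE, hE0⟩

/-! ### Direct sums of subcoalgebras induce direct sums of comodules. -/

section Decomposition

theorem exists_dual_of_isCompl {D E : Submodule k C} (h : IsCompl D E) :
    ∃ e : Module.Dual k C, (∀ c ∈ D, e c = counit c) ∧ ∀ c ∈ E, e c = 0 := by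
  refine ⟨LinearMap.ofIsCompl h (counit ∘ₗ D.subtype) 0, fun c hc => ?_, fun c hc => ?_⟩
  · simpa using LinearMap.ofIsCompl_apply_left h (φ := counit ∘ₗ D.subtype) (ψ := 0) ⟨c, hc⟩
  · simpa using LinearMap.ofIsCompl_apply_right h (φ := counit ∘ₗ D.subtype) (ψ := 0) ⟨c, hc⟩

variable [RightComodule k C M]

/-- If `f` kills `D`, then `f * e` vanishes on `D` because of `f` and on `E` because of `e`. -/
theorem act_mem_coeffIn {D E : Submodule k C} (hD : IsSubcoalgebra D) (hE : IsSubcoalgebra E)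
    (h : D ⊔ E = ⊤) {e : Module.Dual k C} (he : ∀ c ∈ E, e c = 0) (x : M) :
    act M e x ∈ coeffIn M D := by
  intro f hf
  have h0 : conv f e = 0 := by
    rw [← Submodule.mem_bot k, ← Submodule.dualAnnihilator_top, ← h,
      Submodule.dualAnnihilator_sup_eq]
    exact ⟨(isSubcoalgebra_iff.1 hD f hf e).1,
      (isSubcoalgebra_iff.1 hE e ((Submodule.mem_dualAnnihilator e).2 he) f).2⟩
  rw [← act_conv, h0]
  simp [act]

theorem isDirectSumOf_iff {V : Type*} [AddCommGroup V] [Module k V] {S : Set (Submodule k V)} :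
    IsDirectSumOf S ↔ sSupIndep S ∧ sSup S = ⊤ := by
  classical
  rw [IsDirectSumOf, DirectSum.isInternal_submodule_iff_iSupIndep_and_iSup_eq_top,
    sSupIndep_iff, sSup_eq_iSup']

theorem isCompl_sSup_diff_singleton {V : Type*} [AddCommGroup V] [Module k V]
    {S : Set (Submodule k V)} (h : IsDirectSumOf S) {D : Submodule k V} (hD : D ∈ S) :
    IsCompl D (sSup (S \ {D})) := by
  rw [isDirectSumOf_iff] at h
  refine ⟨h.1 hD, codisjoint_iff.2 ?_⟩
  rw [← sSup_insert, Set.insert_sdiff_singleton, Set.insert_eq_of_mem hD, h.2]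

/-- `⊥` is removed because some `coeffIn M D` may vanish, and zero is not relative-irreducible. -/
theorem isDirectSumOf_coeffIn {S : Set (Submodule k C)} (hS : ∀ D ∈ S, IsSubcoalgebra D)
    (h : IsDirectSumOf S) : IsDirectSumOf (coeffIn M '' S \ {⊥}) := by
  have hc := fun D hD => isCompl_sSup_diff_singleton h (D := D) hD
  rw [isDirectSumOf_iff] at h ⊢
  constructor
  · have : iSupIndep fun D : S => coeffIn M (D : Submodule k C) := by
      rintro ⟨D, hD⟩
      have hle : ⨆ (j : S) (_ : j ≠ ⟨D, hD⟩), coeffIn M (j : Submodule k C) ≤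
          coeffIn M (sSup (S \ {D})) :=
        iSup₂_le fun j hj => coeffIn_mono (le_sSup ⟨j.2, fun h => hj (Subtype.ext h)⟩)
      refine Disjoint.mono_right hle ?_
      rw [disjoint_iff, ← coeffIn_inf, (hc D hD).inf_eq_bot, coeffIn_bot]
    have h2 := this.sSupIndep_range
    refine h2.mono fun N hN => ?_
    obtain ⟨D, hD, rfl⟩ := hN.1
    exact ⟨⟨D, hD⟩, rfl⟩
  · rw [sSup_sdiff_singleton_bot, eq_top_iff]
    rintro x -
    refine mem_of_forall_dualAnnihilator fun φ hφ => ?_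
    -- It remains to kill `ε(coeff φ x)`. On each component of `coeff φ x` in a summand `D`, `ε`
    -- agrees with a functional `e` vanishing on the other summands, and `e (coeff φ x) = φ(e · x) =
    -- 0` as `e · x ∈ coeffIn M D`.
    rw [← act_counit (k := k) (C := C) x, ← apply_coeff]
    have hx : ∀ e : Module.Dual k C, ∀ D ∈ S, (∀ c ∈ sSup (S \ {D}), e c = 0) →
        e (coeff φ x) = 0 := fun e D hD he => by
      rw [apply_coeff]
      exact (Submodule.mem_dualAnnihilator φ).1 hφ _ (le_sSup (α := Submodule k M) (Set.mem_image_of_mem _ hD)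
        (act_mem_coeffIn (hS D hD) (isSubcoalgebra_sSup fun E hE => hS E hE.1)
          (hc D hD).sup_eq_top he x))
    have hmem : coeff φ x ∈ ⨆ D : S, (D : Submodule k C) := by
      rw [← sSup_eq_iSup', h.2]; trivial
    obtain ⟨p, hp, hsum⟩ := (Submodule.mem_iSup_iff_exists_finsupp _ _).1 hmem
    rw [← hsum, Finsupp.sum, map_sum]
    refine Finset.sum_eq_zero fun D hD => ?_
    obtain ⟨e, he, he'⟩ := exists_dual_of_isCompl (hc D D.2)
    rw [← he _ (hp D)]
    have h1 := hx e D D.2 he'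
    rw [← hsum, Finsupp.sum, map_sum, Finset.sum_eq_single D] at h1
    · exact h1
    · intro E _ hED
      have hle : (E : Submodule k C) ≤ sSup (S \ {(D : Submodule k C)}) :=
        le_sSup ⟨E.2, fun h => hED (Subtype.ext h)⟩
      exact he' _ (hle (hp E))
    · intro h; exact absurd hD h

end Decomposition

end

/-! ### The claims of the corollary. -/

section Main

variable {k : Type u} {C : Type v} [Field k] [AddCommGroup C] [Module k C] [Coalgebra k C]

theorem IsPiCommutativeCoalgebra.isPiCommutativeComodule (h : IsPiCommutativeCoalgebra k C)
    (M : Type w) [AddCommGroup M] [Module k M] [RightComodule k C M] :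
    IsPiCommutativeComodule k C M := by
  intro N L hN hL
  rw [comoduleWedge_eq, comoduleWedge_eq,
    h _ _ hN.isSimpleSubcoalgebra_coeffSpace hL.isSimpleSubcoalgebra_coeffSpace]

theorem IsDecomposableCoalgebra.isDecomposableComodule (h : IsDecomposableCoalgebra k C)
    (M : Type w) [AddCommGroup M] [Module k M] [RightComodule k C M]
    (hM : IsComponentFaithful k C M) : IsDecomposableComodule k C M := by
  obtain ⟨D, E, hD, hE, hD0, hE0, hDE⟩ := h
  have hne : ∀ D : Submodule k C, IsSubcoalgebra D → D ≠ ⊥ → coeffIn M D ≠ ⊥ := by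
    intro D hD hD0 hbot
    obtain ⟨F, hFD, hF, hF0⟩ := hD.exists_isSimpleSubcoalgebra_le hD0
    have := (hM F hF).resolve_right hF0
    rw [component_eq_coeffIn hF.1] at this
    exact this (eq_bot_iff.2 (hbot ▸ coeffIn_mono hFD))
  refine ⟨coeffIn M D, coeffIn M E, (isClosedSubcomodule_coeffIn hD).isWeakClosedSubcomodule,
    (isClosedSubcomodule_coeffIn hE).isWeakClosedSubcomodule, hne D hD hD0, hne E hE hE0, ?_, ?_⟩
  · rw [disjoint_iff, ← coeffIn_inf, hDE.inf_eq_bot, coeffIn_bot]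
  · rw [codisjoint_iff, eq_top_iff]
    rintro x -
    obtain ⟨e, he, he'⟩ := exists_dual_of_isCompl hDE
    -- `e` and `ε - e` are the projections: each vanishes on one of the two summands of `C`.
    have key : x = act M e x + act M (counit + (-1 : k) • e) x := by
      rw [act_add_left, act_smul_left, act_counit]
      simp
    rw [key]
    refine Submodule.add_mem_sup (act_mem_coeffIn hD hE hDE.sup_eq_top he' x)
      (act_mem_coeffIn hE hD hDE.symm.sup_eq_top (fun c hc => ?_) x)
    simp [he c hc]

theorem IsIrreducibleCoalgebra.isRelativeIrreducibleComodule (h : IsIrreducibleCoalgebra k C)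
    (M : Type w) [AddCommGroup M] [Module k M] [RightComodule k C M] (hM : Nontrivial M) :
    IsRelativeIrreducibleComodule k C M := by
  have htop : coeffIn M (⊤ : Submodule k C) = ⊤ :=
    eq_top_iff.2 (coeffSpace_le_iff.1 le_top)
  rw [IsRelativeIrreducibleComodule, ← htop]
  exact isRelativeIrreducibleSubcomodule_coeffIn h (by rw [htop]; exact top_ne_bot)

theorem IsComponentFaithful.nontrivial {M : Type w} [AddCommGroup M] [Module k M]
    [RightComodule k C M] (hM : IsComponentFaithful k C M) {D : Submodule k C}
    (hD : IsSubcoalgebra D) (hD0 : D ≠ ⊥) : Nontrivial M := by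
  obtain ⟨E, -, hE, hE0⟩ := hD.exists_isSimpleSubcoalgebra_le hD0
  by_contra hM'
  have := not_nontrivial_iff_subsingleton.1 hM'
  exact (hM E hE).resolve_right hE0 (Subsingleton.elim _ _)

theorem isIrreducibleCoalgebra_of_forall
    (h : ∀ (M : Type (max v w)) [AddCommGroup M] [Module k M] [RightComodule k C M],
      IsComponentFaithful k C M → IsRelativeIrreducibleComodule k C M) :
    IsIrreducibleCoalgebra k C := by
  -- The regular comodule must be lifted to the universe over which `h` quantifies.
  let e : ULift.{w} C ≃ₗ[k] C := ULift.moduleEquiv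
  let := comoduleOfEquiv e
  have hne : ∀ D : Submodule k C, IsSubcoalgebra D → D ≠ ⊥ → coeffIn (ULift.{w} C) D ≠ ⊥ := by
    intro D hD hD0 hbot
    obtain ⟨c, hc, hc0⟩ := Submodule.exists_mem_ne_zero_of_ne_bot hD0
    have h1 : e.symm c ∈ coeffIn (ULift.{w} C) D :=
      coeffSpace_le_iff.1 (coeffSpace_comoduleOfEquiv_le e hD) (by simpa using hc)
    rw [hbot, Submodule.mem_bot] at h1
    exact hc0 (by simpa using h1)
  obtain ⟨-, P, ⟨-, hP0, -⟩, huniq⟩ := h (ULift.{w} C) fun D hD => by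
    rw [component_eq_coeffIn hD.1]
    exact or_iff_not_imp_right.2 (hne D hD.1)
  have htop : IsSubcoalgebra (⊤ : Submodule k C) :=
    isSubcoalgebra_iff.2 fun f hf g => by
      rw [Submodule.dualAnnihilator_top, Submodule.mem_bot] at *
      subst hf
      exact ⟨congrArg WithConv.ofConv (zero_mul (WithConv.toConv g)),
        congrArg WithConv.ofConv (mul_zero (WithConv.toConv g))⟩
  refine ⟨htop, fun hbot => hP0 ?_, fun E F hE hF _ _ hE0 hF0 hinf => ?_⟩
  · rw [eq_bot_iff, ← coeffIn_bot (k := k) (C := C), ← hbot]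
    exact coeffSpace_le_iff.1 le_top
  · obtain ⟨D, hDE, hD, hD0⟩ := hE.exists_isSimpleSubcoalgebra_le hE0
    obtain ⟨G, hGF, hG, hG0⟩ := hF.exists_isSimpleSubcoalgebra_le hF0
    have h1 := huniq _ ⟨isMinimalClosedSubcomodule_coeffIn hD, hne D hD.1 hD0, le_top⟩
    have h2 := huniq _ ⟨isMinimalClosedSubcomodule_coeffIn hG, hne G hG.1 hG0, le_top⟩
    -- Uniqueness gives `P = coeffIn D = coeffIn G`, so `P` is `coeffIn (D ⊓ G)`, which is zero
    -- because `E ⊓ F` is.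
    apply hP0
    rw [← inf_idem P]
    nth_rw 1 [← h1]
    rw [← h2, ← coeffIn_inf, eq_bot_iff, ← coeffIn_bot (k := k) (C := C), ← hinf]
    exact coeffIn_mono (inf_le_inf hDE hGF)

end Main

end ComoduleDecomposition

theorem corollary1p10 (k : Type u) [Field k] (C : Type v) [AddCommGroup C] [Module k C]
    [Coalgebra k C] :
    (IsPiCommutativeCoalgebra k C →
      ∀ (M : Type w) [AddCommGroup M] [Module k M] [RightComodule k C M],
        IsPiCommutativeComodule k C M) ∧
    ((∃ S : Set (Submodule k C), (∀ D ∈ S, IsIrreducibleSubcoalgebra D) ∧ IsDirectSumOf S) →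
      ∀ (M : Type w) [AddCommGroup M] [Module k M] [RightComodule k C M],
        ∃ T : Set (Submodule k M),
          (∀ N ∈ T, IsRelativeIrreducibleSubcomodule C N) ∧ IsDirectSumOf T) ∧
    (IsDecomposableCoalgebra k C →
      ∀ (M : Type w) [AddCommGroup M] [Module k M] [RightComodule k C M],
        IsComponentFaithful k C M → IsDecomposableComodule k C M) ∧
    (IsIrreducibleCoalgebra k C →
      ∀ (M : Type w) [AddCommGroup M] [Module k M] [RightComodule k C M],
        Nontrivial M → IsRelativeIrreducibleComodule k C M) ∧
    (IsIrreducibleCoalgebra k C ↔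
      ∀ (M : Type (max v w)) [AddCommGroup M] [Module k M] [RightComodule k C M],
        IsComponentFaithful k C M → IsRelativeIrreducibleComodule k C M) := by
  refine ⟨fun h M _ _ _ => h.isPiCommutativeComodule M, ?_,
    fun h M _ _ _ => h.isDecomposableComodule M,
    fun h M _ _ _ => h.isRelativeIrreducibleComodule M,
    fun h M _ _ _ hM => h.isRelativeIrreducibleComodule M (hM.nontrivial h.1 h.2.1),
    isIrreducibleCoalgebra_of_forall.{u, v, w}⟩
  rintro ⟨S, hS, hsum⟩ M _ _ _
  refine ⟨coeffIn M '' S \ {⊥}, ?_, isDirectSumOf_coeffIn (fun D hD => (hS D hD).1) hsum⟩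
  rintro _ ⟨⟨D, hD, rfl⟩, hne⟩
  exact isRelativeIrreducibleSubcomodule_coeffIn (hS D hD) hne
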